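/- Let $G$ be a connected finite undirected multigraph without loops, with vertices $v_0,\dots,v_n$ and adjacency matrix $A$. Let $R=(r_0,\dots,r_n)$ be a vector of positive integers with $\gcd(r_0,\dots,r_n)=1$, and let $\delta_0,\dots,\delta_n$ be natural numbers with $(\mathrm{diag}(\delta_0,\dots,\delta_n)-A)R=0$; that is, $(G,R)$ is an arithmetical graph with Laplacian $Q=\mathrm{diag}(\delta_0,\dots,\delta_n)-A$. Let $\Lambda_{(G,R)}\subseteq\mathbb Z^{n+1}$ be the lattice spanned by the columns of $Q$, and define $g_0$ by $2g_0-2=\sum_{i=0}^n r_i(\delta_i-2)$. For a positive integer vector $S\in\mathbb Z^{n+1}$ write $\deg_S(D)=S\cdot D$, and let $\Lambda$ be a sublattice of rank $n$ of $\{D\in\mathbb Z^{n+1}:\deg_S(D)=0\}$. For $D\in\mathbb Z^{n+1}$ put $|D|=\{E\ge 0: E-D\in\Lambda\}$ and $$r(D)=\min\{\deg_S(E): E\ge 0,\ |D-E|=\emptyset\}-1 .$$ Let $\Sigma(\Lambda)=\{D\in\mathbb Z^{n+1}: D\not\ge p\text{ for all }p\in\Lambda\}$, and let $\mathrm{Ext}(\Sigma(\Lambda))$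 be the set of $\nu\in\Sigma(\Lambda)$ such that $\deg_S(\nu)\ge\deg_S(p)$ for all $p\in\Sigma(\Lambda)$ with $\sum_i|p_i-\nu_i|\le 1$. Let $g_{\min}$ and $g_{\max}$ be the minimum and the maximum of $\deg_S(\nu)+1$ over $\nu\in\mathrm{Ext}(\Sigma(\Lambda))$. The lattice $\Lambda$ has the Riemann–Roch property with canonical divisor $K\in\mathbb Z^{n+1}$ if $g_{\min}=g_{\max}=:g$, $\deg_S(K)=2g-2$, and $r(D)-r(K-D)=\deg_S(D)-g+1$ for all $D\in\mathbb Z^{n+1}$. It has the Riemann–Roch property if this holds for some $K$. Let $\vec G_R$ be the directed multigraph obtained from $(G,R)$ by replacing each edge between $v_i$ and $v_j$ by $r_j$ edges directed from $v_i$ to $v_j$ and $r_i$ edges directed from $v_j$ to $v_i$. Let $\deg^+(v_i)$ be the number of edges of $\vec G_R$ leaving $v_i$, and let $\Lambda_{\vec G_R}$ be the lattice spanned by the rows of the Laplacian $\mathrm{diag}(\deg^+(v_0),\dots,\deg^+(v_n))-\vec A$ of $\vec G_R$, where $\vec A_{i,j}$ is the number of edges from $v_i$ to $v_j$. **Theorem.**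 If $g_0=g_{\min}=g_{\max}$ for $\Lambda_{(G,R)}$ (with $S=R$), then $(G,R)$ has the Riemann–Roch property, i.e. $\Lambda_{(G,R)}$ (with $S=R$) has it. Moreover, $\vec G_R$ has the natural Riemann–Roch property: $\Lambda_{\vec G_R}$ (with $S=(1,\dots,1)$) has the Riemann–Roch property with canonical divisor $K$ given by $K(v_i)=\deg^+(v_i)-2$ for $0\le i\le n$. (In particular both lattices have rank $n$ and are orthogonal to the respective vector $S$.) -/

import Mathlib

namespace ChipFiring

/-! ### Riemann-Roch theory for full-rank sublattices of the lattice orthogonal to `R` -/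

section Lattice

variable {V : Type*} [Fintype V]

/-- The degree `deg_R(D) = R · D` of a divisor `D`. -/
def deg (R : V → ℕ) (D : V → ℤ) : ℤ := ∑ v, (R v : ℤ) * D v

/-- `Λ` is a sublattice of rank `|V| - 1` of `Λ_R = {D : deg_R(D) = 0}`. -/
def IsFullRankSublattice (R : V → ℕ) (L : Submodule ℤ (V → ℤ)) : Prop :=
  (∀ D ∈ L, deg R D = 0) ∧ Module.finrank ℤ L + 1 = Fintype.card V

/-- The linear system `|D|`: the effective divisors that are equivalent to `D` modulo `Λ`. -/
def linearSystem (L : Submodule ℤ (V → ℤ)) (D : V → ℤ) : Set (V → ℤ) :=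
  {E | 0 ≤ E ∧ E - D ∈ L}

/-- The degrees of the effective divisors `E` such that `|D - E|` is empty. -/
def rankSet (R : V → ℕ) (L : Submodule ℤ (V → ℤ)) (D : V → ℤ) : Set ℤ :=
  {m | ∃ E : V → ℤ, 0 ≤ E ∧ linearSystem L (D - E) = ∅ ∧ deg R E = m}

/-- The rank `r(D) = min {deg_R(E) : |D - E| = ∅, E ≥ 0} - 1`. For `Λ ⊆ Λ_R` with `R` positive
the infimum is a minimum, see `isLeast_rankSet`. -/
noncomputable def rank (R : V → ℕ) (L : Submodule ℤ (V → ℤ)) (D : V → ℤ) : ℤ :=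
  sInf (rankSet R L D) - 1

theorem isLeast_rankSet [Nonempty V] {R : V → ℕ} (hR : ∀ v, 0 < R v)
    {L : Submodule ℤ (V → ℤ)} (hL : ∀ D ∈ L, deg R D = 0) (D : V → ℤ) :
    IsLeast (rankSet R L D) (sInf (rankSet R L D)) := by
  have hpos : ∀ E : V → ℤ, 0 ≤ E → 0 ≤ deg R E := fun E hE =>
    Finset.sum_nonneg fun v _ => mul_nonneg (Int.natCast_nonneg _) (hE v)
  have hsub : ∀ A B : V → ℤ, deg R (A - B) = deg R A - deg R B := fun A B => by
    simp [deg, mul_sub, Finset.sum_sub_distrib]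
  have hbdd : BddBelow (rankSet R L D) := ⟨0, by
    rintro m ⟨E, hE, -, rfl⟩
    exact hpos E hE⟩
  have hne : (rankSet R L D).Nonempty := by
    let E : V → ℤ := fun v => |D v| + 1
    refine ⟨deg R E, E, fun v => by simp only [Pi.zero_apply, E]; positivity, ?_, rfl⟩
    rw [Set.eq_empty_iff_forall_notMem]
    rintro F ⟨hF, hFL⟩
    have h1 : deg R F - (deg R D - deg R E) = 0 := by rw [← hsub, ← hsub]; exact hL _ hFL
    have h2 : deg R D < deg R E := by
      refine Finset.sum_lt_sum_of_nonempty Finset.univ_nonempty fun v _ => ?_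
      have h3 : (0 : ℤ) < R v := by exact_mod_cast hR v
      have h4 : D v < |D v| + 1 := by linarith [le_abs_self (D v)]
      exact mul_lt_mul_of_pos_left h4 h3
    linarith [hpos F hF]
  exact ⟨Int.csInf_mem hne hbdd, fun m hm => csInf_le hbdd hm⟩

/-- `Σ(Λ)`: the divisors that dominate no point of `Λ`. -/
def sigmaRegion (L : Submodule ℤ (V → ℤ)) : Set (V → ℤ) :=
  {D | ∀ p ∈ L, ¬ p ≤ D}

/-- `Ext(Σ(Λ))`: the points of `Σ(Λ)` whose degree is maximal among the points of `Σ(Λ)` at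
`ℓ¹`-distance at most one. -/
def extremeDivisors (R : V → ℕ) (L : Submodule ℤ (V → ℤ)) : Set (V → ℤ) :=
  {D | D ∈ sigmaRegion L ∧ ∀ p ∈ sigmaRegion L, ∑ v, |p v - D v| ≤ 1 → deg R p ≤ deg R D}

/-- `g = g_min = min {deg_R(D) : D ∈ Ext(Σ(Λ))} + 1`, where the minimum is attained. -/
def IsGMin (R : V → ℕ) (L : Submodule ℤ (V → ℤ)) (g : ℤ) : Prop :=
  IsLeast (deg R '' extremeDivisors R L) (g - 1)

/-- `g = g_max = max {deg_R(D) : D ∈ Ext(Σ(Λ))} + 1`, where the maximum is attained. -/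
def IsGMax (R : V → ℕ) (L : Submodule ℤ (V → ℤ)) (g : ℤ) : Prop :=
  IsGreatest (deg R '' extremeDivisors R L) (g - 1)

/-- `Λ` is a full-rank sublattice of `Λ_R`, it is uniform, `K` has degree `2g - 2` where
`g = g_min = g_max`, and the Riemann-Roch formula holds for `K`. -/
def HasRiemannRochWith (R : V → ℕ) (L : Submodule ℤ (V → ℤ)) (K : V → ℤ) : Prop :=
  IsFullRankSublattice R L ∧
    ∃ g : ℤ, IsGMin R L g ∧ IsGMax R L g ∧ deg R K = 2 * g - 2 ∧
      ∀ D : V → ℤ, rank R L D - rank R L (K - D) = deg R D - g + 1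

/-- The Riemann-Roch property of the lattice `Λ` in `Λ_R`. -/
def HasRiemannRoch (R : V → ℕ) (L : Submodule ℤ (V → ℤ)) : Prop :=
  ∃ K : V → ℤ, HasRiemannRochWith R L K

end Lattice

/-! ### Directed multigraphs and the row chip-firing game -/

/-- A strongly connected directed multigraph without loops, given by the numbers `arcs u v` of
edges directed from `u` to `v`. -/
structure DirectedMultigraph (V : Type*) where
  arcs : V → V → ℕ
  loopless : ∀ v, arcs v v = 0
  strongly_connected : ∀ u v, Relation.ReflTransGen (fun a b => arcs a b ≠ 0) u v

namespace DirectedMultigraph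

variable {V : Type*} [Fintype V] (H : DirectedMultigraph V)

/-- The number `deg⁺(v)` of edges leaving `v`. -/
def outDegree (v : V) : ℕ := ∑ u, H.arcs v u

/-- The adjacency matrix. -/
def adjMatrix : Matrix V V ℤ := Matrix.of fun u v => (H.arcs u v : ℤ)

/-- The Laplacian matrix `diag(deg⁺) - A`. -/
def laplacian [DecidableEq V] : Matrix V V ℤ :=
  Matrix.diagonal (fun v => (H.outDegree v : ℤ)) - H.adjMatrix

/-- The lattice spanned by the rows of the Laplacian (row chip-firing game). -/
def rowLattice [DecidableEq V] : Submodule ℤ (V → ℤ) :=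
  Submodule.span ℤ (Set.range H.laplacian.row)

/-- The divisor whose entry at `v` is `deg⁺(v) - 2`. -/
def naturalDivisor (v : V) : ℤ := (H.outDegree v : ℤ) - 2

/-- The natural Riemann-Roch property (for the row chip-firing game, whose lattice is orthogonal
to the all-ones vector): the Riemann-Roch property with canonical divisor `deg⁺(v) - 2`. -/
def HasNaturalRiemannRoch [DecidableEq V] : Prop :=
  HasRiemannRochWith (fun _ => 1) H.rowLattice H.naturalDivisor

end DirectedMultigraph

/-! ### Arithmetical graphs -/

/-- A connected undirected multigraph without loops, given by the numbers `mult u v` of edges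
between `u` and `v`. -/
structure ConnectedMultigraph (V : Type*) where
  mult : V → V → ℕ
  symm : ∀ u v, mult u v = mult v u
  loopless : ∀ v, mult v v = 0
  connected : (SimpleGraph.fromRel fun u v => mult u v ≠ 0).Connected

/-- The adjacency matrix of a multigraph. -/
def ConnectedMultigraph.adjMatrix {V : Type*} (G : ConnectedMultigraph V) : Matrix V V ℤ :=
  Matrix.of fun u v => (G.mult u v : ℤ)

/-- An arithmetical graph `(G, R)`: positive multiplicities `R = (r_v)` with greatest common
divisor one and natural numbers `δ_v` such that `(diag(δ) - A) R = 0`. -/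
structure ArithmeticalGraph (V : Type*) [Fintype V] [DecidableEq V] extends
    ConnectedMultigraph V where
  r : V → ℕ
  r_pos : ∀ v, 0 < r v
  gcd_r : Finset.univ.gcd r = 1
  δ : V → ℕ
  laplacian_mulVec :
    (Matrix.diagonal (fun v => (δ v : ℤ)) - toConnectedMultigraph.adjMatrix).mulVec
      (fun v => (r v : ℤ)) = 0

namespace ArithmeticalGraph

variable {V : Type*} [Fintype V] [DecidableEq V] (G : ArithmeticalGraph V)

/-- The Laplacian `Q = diag(δ) - A`. -/
def laplacian : Matrix V V ℤ :=
  Matrix.diagonal (fun v => (G.δ v : ℤ)) - G.adjMatrix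

/-- The lattice `Λ_(G,R)` spanned by the columns of the Laplacian. -/
def lattice : Submodule ℤ (V → ℤ) :=
  Submodule.span ℤ (Set.range G.laplacian.col)

/-- `g = g_0`, the number defined by `2 g_0 - 2 = ∑ r_v (δ_v - 2)`. -/
def IsGZero (g : ℤ) : Prop :=
  2 * g - 2 = ∑ v, (G.r v : ℤ) * ((G.δ v : ℤ) - 2)

/-- The directed graph `G_R`: each edge between `u` and `v` is replaced by `r_v` edges directed
from `u` to `v` and `r_u` edges directed from `v` to `u`. -/
def toDirected : DirectedMultigraph V where
  arcs u v := G.mult u v * G.r v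
  loopless v := by simp [G.loopless]
  strongly_connected u v := by
    have h := G.connected.preconnected u v
    rw [SimpleGraph.reachable_iff_reflTransGen] at h
    refine Relation.ReflTransGen.mono (fun a b hab => ?_) _ _ h
    rw [SimpleGraph.fromRel_adj] at hab
    have hm : G.mult a b ≠ 0 := by
      rcases hab.2 with h | h
      · exact h
      · rw [G.symm]; exact h
    exact mul_ne_zero hm (G.r_pos b).ne'

end ArithmeticalGraph

end ChipFiring

namespace ChipFiring

/-! ### Riemann–Roch from a reflection of the top-degree points of `sigmaRegion` -/

section Lattice

variable {V : Type*} [Fintype V]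

/-! Write Q for the Laplacian. A divisor D lies in Σ(Λ) exactly when it admits a `FiringCycle`: if
no Qf is ≤ D, scripts can be fired forever within finitely many configurations, so one recurs
(`nonempty_firingCycle`); conversely, a cycle cannot cross a script q with Qq ≤ D
(`FiringCycle.mem_sigmaRegion`).

The quadratic `potential` turns the total slack of a cycle into k(g₀ - 1 - deg D). Hence deg D ≤ g₀
- 1 on Σ(Λ). In case of equality every firing is tight and the reversed cycle is a firing cycle for
K - D, where K = δ - 2. Since g_min = g₀, every point of Σ(Λ) lies below one of degree g₀ - 1, and
`hasRiemannRochWith_of_reflection` applies.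

The lattice of the directed graph is the image of Λ under coordinatewise multiplication by r.
Rounding D/r down and `inflate` carry bound, domination and reflection over to it. -/

theorem deg_add (R : V → ℕ) (A B : V → ℤ) : deg R (A + B) = deg R A + deg R B := by
  simp [deg, mul_add, Finset.sum_add_distrib]

theorem deg_sub (R : V → ℕ) (A B : V → ℤ) : deg R (A - B) = deg R A - deg R B := by
  simp [deg, mul_sub, Finset.sum_sub_distrib]

theorem deg_mono (R : V → ℕ) {A B : V → ℤ} (h : A ≤ B) : deg R A ≤ deg R B :=
  Finset.sum_le_sum fun v _ => mul_le_mul_of_nonneg_left (h v) (Int.natCast_nonneg _)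

theorem eq_of_le_of_deg_le {R : V → ℕ} (hR : ∀ v, 0 < R v) {A B : V → ℤ} (h : A ≤ B)
    (hd : deg R B ≤ deg R A) : A = B := by
  have h0 := (Finset.sum_eq_sum_iff_of_le fun v (_ : v ∈ Finset.univ) =>
    mul_le_mul_of_nonneg_left (h v) (Int.natCast_nonneg (R v))).1 (le_antisymm (deg_mono R h) hd)
  ext v
  exact mul_left_cancel₀ (by exact_mod_cast (hR v).ne') (h0 v (Finset.mem_univ v))

omit [Fintype V] in
theorem sigmaRegion_of_le {L : Submodule ℤ (V → ℤ)} {D E : V → ℤ} (hE : E ∈ sigmaRegion L)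
    (h : D ≤ E) : D ∈ sigmaRegion L :=
  fun p hp hpD => hE p hp (hpD.trans h)

omit [Fintype V] in
theorem linearSystem_eq_empty_iff {L : Submodule ℤ (V → ℤ)} {D : V → ℤ} :
    linearSystem L D = ∅ ↔ D ∈ sigmaRegion L := by
  rw [Set.eq_empty_iff_forall_notMem]
  constructor
  · intro h p hp hpD
    refine h (D - p) ⟨sub_nonneg.2 hpD, ?_⟩
    rw [sub_sub_cancel_left]
    exact L.neg_mem hp
  · rintro h E ⟨hE, hED⟩
    refine h (-(E - D)) (L.neg_mem hED) ?_
    rw [neg_sub]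
    exact sub_le_self D hE

/-- Every divisor whose degree is maximal on `Σ(Λ)` above a given divisor is extreme. -/
theorem mem_extremeDivisors_of_maximal {R : V → ℕ} {L : Submodule ℤ (V → ℤ)} {D : V → ℤ}
    (hD : D ∈ sigmaRegion L) (hmax : ∀ E ∈ sigmaRegion L, D ≤ E → deg R E ≤ deg R D) :
    D ∈ extremeDivisors R L := by
  classical
  refine ⟨hD, fun p hp hpD => ?_⟩
  by_cases h : D ≤ p
  · exact hmax p hp h
  -- One coordinate of p is below D, which uses up the whole ℓ¹ budget, so none can be above.
  · refine deg_mono R fun w => ?_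
    by_contra! hw
    obtain ⟨v, hv⟩ : ∃ v, p v < D v := by simpa [Pi.le_def] using h
    have hvw : v ≠ w := by rintro rfl; exact lt_asymm hv hw
    have hw' : D w < p w := hw
    have h1 : ∑ x ∈ {v, w}, |p x - D x| ≤ ∑ x, |p x - D x| :=
      Finset.sum_le_sum_of_subset_of_nonneg (Finset.subset_univ _) fun _ _ _ => abs_nonneg _
    rw [Finset.sum_pair hvw] at h1
    have h2 := neg_le_abs (p v - D v)
    have h3 := le_abs_self (p w - D w)
    omega

/-- If the degree is bounded on `Σ(Λ)`, each of its points lies below an extreme divisor. -/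
theorem exists_extremeDivisors_ge {R : V → ℕ} {L : Submodule ℤ (V → ℤ)} {b : ℤ}
    (hb : ∀ D ∈ sigmaRegion L, deg R D ≤ b) {D : V → ℤ} (hD : D ∈ sigmaRegion L) :
    ∃ E ∈ extremeDivisors R L, D ≤ E := by
  obtain ⟨m, ⟨E, hE, hDE, rfl⟩, hm⟩ := Int.exists_greatest_of_bdd
    (P := fun m => ∃ E ∈ sigmaRegion L, D ≤ E ∧ deg R E = m)
    ⟨b, by rintro m ⟨E, hE, -, rfl⟩; exact hb E hE⟩ ⟨_, D, hD, le_rfl, rfl⟩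
  exact ⟨E, mem_extremeDivisors_of_maximal hE
    fun F hF hEF => hm _ ⟨F, hF, hDE.trans hEF, rfl⟩, hDE⟩

/-- A point strictly below some E in Σ(Λ) can be raised by one in a coordinate without leaving Σ(Λ),
which increases the degree. -/
theorem deg_extremeDivisors {R : V → ℕ} (hR : ∀ v, 0 < R v) {L : Submodule ℤ (V → ℤ)} {m : ℤ}
    (hdom : ∀ D ∈ sigmaRegion L, ∃ E ∈ sigmaRegion L, D ≤ E ∧ deg R E = m) {D : V → ℤ}
    (hD : D ∈ extremeDivisors R L) : deg R D = m := by
  classical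
  obtain ⟨E, hE, hDE, rfl⟩ := hdom D hD.1
  by_contra hne
  obtain ⟨v, hv⟩ : ∃ v, D v < E v := by
    by_contra! h
    exact hne (congrArg _ (le_antisymm hDE h))
  have hle : D + Pi.single v 1 ≤ E := by
    intro w
    rcases eq_or_ne w v with rfl | hw
    · simpa using hv
    · simpa [hw] using hDE w
  have h := hD.2 _ (sigmaRegion_of_le hE hle) (by
    rw [Finset.sum_eq_single v] <;> simp +contextual)
  have h1 : deg R (Pi.single v 1) = R v := by simp [deg, Pi.single_apply]
  have h2 := hR v
  rw [deg_add, h1] at h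
  omega

/-- Half of Riemann–Roch. If E realizes the rank of D and F ≥ D - E has degree m, then E - (D - F)
is effective and competes for the rank of K - D, because subtracting it leaves K - F - E ≤ K - F. -/
theorem rank_sub_le {R : V → ℕ} [Nonempty V] (hR : ∀ v, 0 < R v) {L : Submodule ℤ (V → ℤ)}
    (hL : ∀ D ∈ L, deg R D = 0) {m : ℤ} {K : V → ℤ}
    (hdom : ∀ D ∈ sigmaRegion L, ∃ E ∈ sigmaRegion L, D ≤ E ∧ deg R E = m)
    (hrefl : ∀ D ∈ sigmaRegion L, deg R D = m → K - D ∈ sigmaRegion L) (D : V → ℤ) :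
    rank R L (K - D) ≤ rank R L D - deg R D + m := by
  obtain ⟨E, hE0, hDE, hE⟩ := (isLeast_rankSet hR hL D).1
  obtain ⟨F, hF, hle, hFm⟩ := hdom _ (linearSystem_eq_empty_iff.1 hDE)
  have h := (isLeast_rankSet hR hL (K - D)).2 ⟨E - (D - F), ?_, linearSystem_eq_empty_iff.2 ?_, rfl⟩
  · rw [deg_sub, deg_sub, hE, hFm] at h
    unfold rank
    linarith
  · intro v
    have := hle v
    simp only [Pi.sub_apply, Pi.zero_apply] at this ⊢
    linarith
  · refine sigmaRegion_of_le (hrefl F hF hFm) fun v => ?_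
    have := hE0 v
    simp only [Pi.sub_apply, Pi.zero_apply] at this ⊢
    linarith

/-- A full-rank lattice for which the points of degree `g - 1` of `Σ(Λ)` have maximal degree,
dominate `Σ(Λ)` and are permuted by `D ↦ K - D` has the Riemann-Roch property. -/
theorem hasRiemannRochWith_of_reflection {R : V → ℕ} (hR : ∀ v, 0 < R v)
    {L : Submodule ℤ (V → ℤ)} (hL : IsFullRankSublattice R L) {g : ℤ} {K : V → ℤ}
    (hK : deg R K = 2 * g - 2) (hne : (sigmaRegion L).Nonempty)
    (hle : ∀ D ∈ sigmaRegion L, deg R D ≤ g - 1)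
    (hdom : ∀ D ∈ sigmaRegion L, ∃ E ∈ sigmaRegion L, D ≤ E ∧ deg R E = g - 1)
    (hrefl : ∀ D ∈ sigmaRegion L, deg R D = g - 1 → K - D ∈ sigmaRegion L) :
    HasRiemannRochWith R L K := by
  have : Nonempty V := Fintype.card_pos_iff.1 (by rw [← hL.2]; exact Nat.succ_pos _)
  have hext : ∀ m ∈ deg R '' extremeDivisors R L, m = g - 1 := by
    rintro _ ⟨D, hD, rfl⟩
    exact deg_extremeDivisors hR hdom hD
  have hmem : g - 1 ∈ deg R '' extremeDivisors R L := by
    obtain ⟨D, hD⟩ := hne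
    obtain ⟨E, hE, -⟩ := exists_extremeDivisors_ge hle hD
    exact ⟨E, hE, deg_extremeDivisors hR hdom hE⟩
  refine ⟨hL, g, ⟨hmem, fun m hm => (hext m hm).ge⟩, ⟨hmem, fun m hm => (hext m hm).le⟩, hK,
    fun D => ?_⟩
  have h1 := rank_sub_le hR hL.1 hdom hrefl D
  -- As deg K = 2(g - 1), the same bound at K - D is the reverse inequality.
  have h2 := rank_sub_le hR hL.1 hdom hrefl (K - D)
  rw [sub_sub_cancel, deg_sub, hK] at h2
  linarith

end Lattice

/-! ### The Laplacian of an arithmetical graph and its kernel -/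

namespace ArithmeticalGraph

open Matrix

variable {V : Type*} [Fintype V] [DecidableEq V] (G : ArithmeticalGraph V)

/-- The multiplicities as an integer vector. -/
def rVec (v : V) : ℤ := G.r v

theorem deg_eq_dotProduct (D : V → ℤ) : deg G.r D = G.rVec ⬝ᵥ D := rfl

theorem rVec_pos (v : V) : 0 < G.rVec v := Int.natCast_pos.2 (G.r_pos v)

theorem laplacian_transpose : G.laplacianᵀ = G.laplacian := by
  have h : G.adjMatrixᵀ = G.adjMatrix :=
    Matrix.ext fun u v => congrArg Nat.cast (G.symm v u)
  rw [laplacian, transpose_sub, diagonal_transpose, h]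

theorem laplacian_mulVec_rVec : G.laplacian *ᵥ G.rVec = 0 := G.laplacian_mulVec

theorem dotProduct_laplacian_mulVec (f h : V → ℤ) :
    f ⬝ᵥ G.laplacian *ᵥ h = h ⬝ᵥ G.laplacian *ᵥ f := by
  rw [dotProduct_mulVec, ← mulVec_transpose, laplacian_transpose, dotProduct_comm]

theorem laplacian_mulVec_apply (f : V → ℤ) (v : V) :
    (G.laplacian *ᵥ f) v = G.δ v * f v - ∑ w, G.mult v w * f w := by
  rw [laplacian, sub_mulVec, Pi.sub_apply, mulVec_diagonal]
  rfl

theorem laplacian_mulVec_single_self (v : V) : (G.laplacian *ᵥ Pi.single v 1) v = G.δ v := by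
  simp [laplacian, ConnectedMultigraph.adjMatrix, G.loopless]

theorem mem_lattice {p : V → ℤ} : p ∈ G.lattice ↔ ∃ f, G.laplacian *ᵥ f = p := by
  rw [lattice, ← range_mulVecLin]
  rfl

theorem deg_laplacian_mulVec (f : V → ℤ) : deg G.r (G.laplacian *ᵥ f) = 0 := by
  rw [deg_eq_dotProduct, dotProduct_laplacian_mulVec, laplacian_mulVec_rVec, dotProduct_zero]

/-- The maximum principle for the Laplacian. -/
theorem eq_zero_of_laplacian_mulVec_eq_zero {f : V → ℤ} (hf : G.laplacian *ᵥ f = 0)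
    (h0 : 0 ≤ f) {v : V} (hv : f v = 0) : f = 0 := by
  -- At a zero of f the equation makes a sum of nonnegative neighbour terms vanish; zeros then
  -- spread by connectedness.
  have key : ∀ a b, G.mult a b ≠ 0 → f a = 0 → f b = 0 := by
    intro a b hab ha
    have h := congrFun hf a
    rw [laplacian_mulVec_apply, ha, mul_zero, zero_sub, Pi.zero_apply, neg_eq_zero,
      Finset.sum_eq_zero_iff_of_nonneg
        fun w _ => mul_nonneg (Int.natCast_nonneg _) (h0 w)] at h
    exact (mul_eq_zero.1 (h b (Finset.mem_univ b))).resolve_left (by exact_mod_cast hab)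
  ext w
  have h := G.connected.preconnected v w
  rw [SimpleGraph.reachable_iff_reflTransGen] at h
  induction h with
  | refl => exact hv
  | tail _ hab ih =>
    rw [SimpleGraph.fromRel_adj] at hab
    refine key _ _ ?_ ih
    rcases hab.2 with h | h
    · exact h
    · rwa [G.symm]

/-- At a vertex v maximizing f/r, the kernel vector f(v)r - r(v)f is nonnegative and vanishes at v,
hence is zero. The ratio f/r is an integer because the gcd of r is one. -/
theorem exists_eq_smul_rVec {f : V → ℤ} (hf : G.laplacian *ᵥ f = 0) : ∃ k : ℤ, f = k • G.rVec := by
  have : Nonempty V := G.connected.nonempty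
  obtain ⟨v, hv⟩ := Finite.exists_max fun v => (f v : ℚ) / G.rVec v
  have h0 : f v • G.rVec - G.rVec v • f = 0 := by
    refine G.eq_zero_of_laplacian_mulVec_eq_zero (v := v) ?_ (fun w => ?_) ?_
    · rw [mulVec_sub, mulVec_smul, mulVec_smul, hf, laplacian_mulVec_rVec]
      simp
    · have h := hv w
      rw [div_le_div_iff₀ (by exact_mod_cast G.rVec_pos w) (by exact_mod_cast G.rVec_pos v)] at h
      have h' : f w * G.rVec v ≤ f v * G.rVec w := by exact_mod_cast h
      simp only [Pi.zero_apply, Pi.sub_apply, Pi.smul_apply, smul_eq_mul]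
      linarith
    · simp [mul_comm]
  have h1 : ∀ w, f v * G.rVec w = G.rVec v * f w := fun w => by
    simpa [sub_eq_zero] using congrFun h0 w
  have hdvd : G.r v ∣ (f v).natAbs := by
    have h2 : G.r v ∣ Finset.univ.gcd fun w => (f v).natAbs * G.r w := by
      refine Finset.dvd_gcd fun w _ => ?_
      have := congrArg Int.natAbs (h1 w)
      rw [Int.natAbs_mul, Int.natAbs_mul] at this
      exact ⟨(f w).natAbs, this⟩
    simpa [Finset.gcd_mul_left, G.gcd_r] using h2
  obtain ⟨k, hk⟩ := Int.natCast_dvd.2 hdvd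
  refine ⟨k, funext fun w => mul_left_cancel₀ (G.rVec_pos v).ne' ?_⟩
  rw [← h1 w, hk, Pi.smul_apply, smul_eq_mul, mul_assoc]
  rfl

theorem isFullRankSublattice_lattice : IsFullRankSublattice G.r G.lattice := by
  constructor
  · intro D hD
    obtain ⟨f, rfl⟩ := G.mem_lattice.1 hD
    exact G.deg_laplacian_mulVec f
  · have : Nonempty V := G.connected.nonempty
    have hker : Module.finrank ℤ (LinearMap.ker G.laplacian.mulVecLin) = 1 := by
      refine finrank_eq_one ⟨G.rVec, G.laplacian_mulVec_rVec⟩ ?_ ?_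
      · intro h
        exact (G.rVec_pos (Classical.arbitrary V)).ne' (congrFun (congrArg Subtype.val h) _)
      · rintro ⟨f, hf⟩
        obtain ⟨k, rfl⟩ := G.exists_eq_smul_rVec hf
        exact ⟨k, rfl⟩
    have h := Submodule.finrank_quotient_add_finrank (LinearMap.ker G.laplacian.mulVecLin)
    rw [G.laplacian.mulVecLin.quotKerEquivRange.finrank_eq, hker, Module.finrank_fintype_fun_eq_card, range_mulVecLin] at h
    exact h

/-! ### Firing cycles and their potential -/

/-- A closed run of the chip-firing game: `N` scripts, each obtained from the previous one by
subtracting the indicator of a vertex `u t` at which the principal divisor of the script exceeds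
`D`, and the last one equal to the first one minus `k` times the multiplicity vector. -/
structure FiringCycle (D : V → ℤ) where
  N : ℕ
  k : ℤ
  f : ℕ → V → ℤ
  u : ℕ → V
  k_pos : 0 < k
  f_succ : ∀ t < N, f (t + 1) = f t - Pi.single (u t) 1
  f_last : f N = f 0 - k • G.rVec
  lt : ∀ t < N, D (u t) < (G.laplacian *ᵥ f t) (u t)

variable {G}

/-- The potential whose decrease in each step of a firing cycle measures the slack. -/
def potential (G : ArithmeticalGraph V) (D f : V → ℤ) : ℤ :=
  f ⬝ᵥ G.laplacian *ᵥ f + f ⬝ᵥ (fun v => (G.δ v : ℤ) - 2 * D v - 2)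

/-- The δ in the linear term cancels the diagonal entry of Q produced by the quadratic term. -/
theorem potential_sub_single (D f : V → ℤ) (v : V) :
    potential G D f - potential G D (f - Pi.single v 1) =
      2 * ((G.laplacian *ᵥ f) v - D v - 1) := by
  have h := G.dotProduct_laplacian_mulVec f (Pi.single v 1)
  have h2 := G.laplacian_mulVec_single_self v
  simp only [potential, mulVec_sub, sub_dotProduct, dotProduct_sub, single_one_dotProduct] at *
  rw [h, h2]
  ring

theorem potential_sub_smul_rVec (D f : V → ℤ) (k : ℤ) :
    potential G D f - potential G D (f - k • G.rVec) =
      k * (∑ v, (G.r v : ℤ) * ((G.δ v : ℤ) - 2) - 2 * deg G.r D) := by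
  have h : G.rVec ⬝ᵥ (fun v => (G.δ v : ℤ) - 2 * D v - 2) =
      ∑ v, (G.r v : ℤ) * ((G.δ v : ℤ) - 2) - 2 * deg G.r D := by
    rw [deg, Finset.mul_sum, ← Finset.sum_sub_distrib]
    exact Finset.sum_congr rfl fun v _ => by rw [rVec]; ring
  have h2 : G.rVec ⬝ᵥ G.laplacian *ᵥ f = 0 := G.deg_laplacian_mulVec f
  simp only [potential, mulVec_sub, mulVec_smul, laplacian_mulVec_rVec, smul_zero, sub_zero,
    sub_dotProduct, smul_dotProduct, h, h2, smul_eq_mul]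
  ring

namespace FiringCycle

variable {D : V → ℤ} (c : G.FiringCycle D)

/-- The potential telescopes over the cycle; since r spans the kernel of Q, only its linear part
changes between the two ends. -/
theorem sum_slack {g : ℤ} (hg : G.IsGZero g) :
    ∑ t ∈ Finset.range c.N, ((G.laplacian *ᵥ c.f t) (c.u t) - D (c.u t) - 1) =
      c.k * (g - 1 - deg G.r D) := by
  have h1 : ∑ t ∈ Finset.range c.N, 2 * ((G.laplacian *ᵥ c.f t) (c.u t) - D (c.u t) - 1) =
      potential G D (c.f 0) - potential G D (c.f c.N) := by
    rw [← Finset.sum_range_sub' (fun t => potential G D (c.f t))]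
    refine Finset.sum_congr rfl fun t ht => ?_
    rw [c.f_succ t (Finset.mem_range.1 ht), potential_sub_single]
  rw [← Finset.mul_sum, c.f_last, potential_sub_smul_rVec, ← hg] at h1
  linarith

include c in
theorem deg_le {g : ℤ} (hg : G.IsGZero g) : deg G.r D ≤ g - 1 := by
  have h : 0 ≤ c.k * (g - 1 - deg G.r D) := by
    rw [← c.sum_slack hg]
    refine Finset.sum_nonneg fun t ht => ?_
    have := c.lt t (Finset.mem_range.1 ht)
    omega
  have := nonneg_of_mul_nonneg_right h c.k_pos
  omega

theorem eq_of_deg_eq {g : ℤ} (hg : G.IsGZero g) (hD : deg G.r D = g - 1) {t : ℕ} (ht : t < c.N) :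
    (G.laplacian *ᵥ c.f t) (c.u t) = D (c.u t) + 1 := by
  have h := c.sum_slack hg
  rw [hD, sub_self, mul_zero, Finset.sum_eq_zero_iff_of_nonneg] at h
  · have := h t (Finset.mem_range.2 ht)
    omega
  · intro s hs
    have := c.lt s (Finset.mem_range.1 hs)
    omega

/-- Running a tight firing cycle backwards. -/
def reflect {g : ℤ} (hg : G.IsGZero g) (hD : deg G.r D = g - 1) :
    G.FiringCycle ((fun v => (G.δ v : ℤ) - 2) - D) where
  N := c.N
  k := c.k
  f t := -c.f (c.N - t)
  u t := c.u (c.N - 1 - t)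
  k_pos := c.k_pos
  f_succ t ht := by
    have h := c.f_succ (c.N - 1 - t) (by omega)
    rw [show c.N - 1 - t + 1 = c.N - t by omega] at h
    rw [h, show c.N - (t + 1) = c.N - 1 - t by omega]
    abel
  f_last := by
    rw [Nat.sub_self, Nat.sub_zero, c.f_last]
    abel
  -- Tightness gives (Qf)(u) = D(u) + 1 before the firing, so the negated script after it has value
  -- δ(u) - D(u) - 1, one more than (K - D)(u).
  lt t ht := by
    have hs : c.N - 1 - t < c.N := by omega
    have h := c.f_succ (c.N - 1 - t) hs
    rw [show c.N - 1 - t + 1 = c.N - t by omega] at h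
    have h1 := c.eq_of_deg_eq hg hD hs
    have h2 := G.laplacian_mulVec_single_self (c.u (c.N - 1 - t))
    rw [h, mulVec_neg, mulVec_sub]
    simp only [Pi.neg_apply, Pi.sub_apply]
    rw [h1, h2]
    omega

-- If Qq ≤ D, take the highest translate of q by multiples of r below the initial script. It stays
-- below every script of the cycle, hence below the last one, and shifting by k • r contradicts its
-- choice.
include c in
theorem mem_sigmaRegion : D ∈ sigmaRegion G.lattice := by
  intro p hp hpD
  obtain ⟨q, rfl⟩ := G.mem_lattice.1 hp
  have : Nonempty V := G.connected.nonempty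
  obtain ⟨j, hj, hjmax⟩ : ∃ j : ℤ, q + j • G.rVec ≤ c.f 0 ∧
      ∀ i : ℤ, q + i • G.rVec ≤ c.f 0 → i ≤ j := by
    refine Int.exists_greatest_of_bdd ?_ ?_
    · let v := Classical.arbitrary V
      refine ⟨|c.f 0 v - q v|, fun i hi => ?_⟩
      have h1 := hi v
      have h2 := G.rVec_pos v
      have h3 := le_abs_self (c.f 0 v - q v)
      have h4 := abs_nonneg (c.f 0 v - q v)
      simp only [Pi.add_apply, Pi.smul_apply, smul_eq_mul] at h1
      by_contra! h
      nlinarith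
    · refine ⟨-∑ v, |c.f 0 v - q v|, fun v => ?_⟩
      have h1 : |c.f 0 v - q v| ≤ ∑ v, |c.f 0 v - q v| :=
        Finset.single_le_sum (fun w _ => abs_nonneg (c.f 0 w - q w)) (Finset.mem_univ v)
      have h2 := G.rVec_pos v
      have h3 := neg_abs_le (c.f 0 v - q v)
      have h4 := abs_nonneg (c.f 0 v - q v)
      simp only [Pi.add_apply, Pi.smul_apply, smul_eq_mul]
      nlinarith
  have hstep : ∀ t ≤ c.N, q + j • G.rVec ≤ c.f t := by
    intro t
    induction t with
    | zero => exact fun _ => hj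
    | succ t ih =>
      intro ht w
      have h := ih (by omega)
      rw [c.f_succ t ht]
      rcases eq_or_ne w (c.u t) with rfl | hw
      · simp only [Pi.sub_apply, Pi.single_eq_same]
        by_contra! hlt
        have heq : c.f t (c.u t) = (q + j • G.rVec) (c.u t) :=
          le_antisymm (by omega) (h _)
        have h1 : (G.laplacian *ᵥ c.f t) (c.u t) ≤
            (G.laplacian *ᵥ (q + j • G.rVec)) (c.u t) := by
          rw [laplacian_mulVec_apply, laplacian_mulVec_apply, heq]
          refine sub_le_sub_left (Finset.sum_le_sum fun w _ => ?_) _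
          exact mul_le_mul_of_nonneg_left (h w) (Int.natCast_nonneg _)
        rw [mulVec_add, mulVec_smul, laplacian_mulVec_rVec, smul_zero, add_zero] at h1
        exact absurd (c.lt t ht) (not_lt.2 (h1.trans (hpD _)))
      · simpa [hw] using h w
  have h := hstep c.N le_rfl
  rw [c.f_last, le_sub_iff_add_le, add_assoc, ← add_smul] at h
  have := hjmax _ h
  have := c.k_pos
  omega

end FiringCycle

/-- A divisor dominating no point of the lattice admits a firing cycle. -/
theorem nonempty_firingCycle {D : V → ℤ} (hD : D ∈ sigmaRegion G.lattice) :
    Nonempty (G.FiringCycle D) := by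
  have hex : ∀ f : V → ℤ, ∃ v, D v < (G.laplacian *ᵥ f) v := fun f => by
    simpa [Pi.le_def] using hD _ (G.mem_lattice.2 ⟨f, rfl⟩)
  choose φ hφ using hex
  let f : ℕ → V → ℤ := fun t => (fun h => h - Pi.single (φ h) 1)^[t] 0
  have hf : ∀ t, f (t + 1) = f t - Pi.single (φ (f t)) 1 := fun t =>
    Function.iterate_succ_apply' _ _ _
  -- A firing vertex starts at D + 1 or more and loses δ; all other vertices lose nothing.
  let b : V → ℤ := fun v => min 0 (D v + 1 - G.δ v)
  have hb : ∀ t, b ≤ G.laplacian *ᵥ f t := by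
    intro t
    induction t with
    | zero =>
      intro v
      simp [f, b]
    | succ t ih =>
      intro v
      rw [hf, mulVec_sub, Pi.sub_apply]
      rcases eq_or_ne v (φ (f t)) with rfl | hv
      · rw [laplacian_mulVec_single_self]
        refine (min_le_right _ _).trans ?_
        linarith [Int.add_one_le_iff.2 (hφ (f t))]
      · have h1 : (G.laplacian *ᵥ Pi.single (φ (f t)) 1) v ≤ 0 := by
          rw [laplacian_mulVec_apply, Pi.single_eq_of_ne hv, mul_zero, zero_sub, neg_nonpos]
          refine Finset.sum_nonneg fun w _ => mul_nonneg (Int.natCast_nonneg _) ?_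
          exact (Pi.single_nonneg.2 zero_le_one : (0 : V → ℤ) ≤ Pi.single (φ (f t)) 1) w
        exact (ih v).trans (le_sub_self_iff _ |>.2 h1)
  -- The lower bound and degree zero with positive weights also bound every entry above, so the
  -- pigeonhole principle yields a recurrence.
  have hbdd : ∀ t, G.laplacian *ᵥ f t ∈ Set.Icc b (fun v => b v - deg G.r b) := by
    intro t
    refine ⟨hb t, fun v => ?_⟩
    have h1 : deg G.r (G.laplacian *ᵥ f t - b) = -deg G.r b := by
      rw [deg_sub, deg_laplacian_mulVec, zero_sub]
    have h2 : G.rVec v * (G.laplacian *ᵥ f t - b) v ≤ deg G.r (G.laplacian *ᵥ f t - b) :=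
      Finset.single_le_sum (f := fun w => G.rVec w * (G.laplacian *ᵥ f t - b) w)
        (fun w _ => mul_nonneg (G.rVec_pos w).le (sub_nonneg.2 (hb t w))) (Finset.mem_univ v)
    have h3 : 0 ≤ (G.laplacian *ᵥ f t - b) v := sub_nonneg.2 (hb t v)
    have h4 := le_mul_of_one_le_left h3 (G.rVec_pos v)
    simp only [Pi.sub_apply] at *
    linarith
  obtain ⟨s, t, hst, heq⟩ := (Set.finite_Icc _ _).exists_lt_map_eq_of_forall_mem hbdd
  obtain ⟨k, hk⟩ := G.exists_eq_smul_rVec (f := f s - f t) (by rw [mulVec_sub, heq, sub_self])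
  have hsum : ∀ t, ∑ v, f t v = -(t : ℤ) := by
    intro t
    induction t with
    | zero => simp [f]
    | succ t ih =>
      simp only [hf, Pi.sub_apply, Finset.sum_sub_distrib, ih, Finset.sum_pi_single',
        Finset.mem_univ, if_true]
      push_cast
      ring
  -- Each firing lowers the coordinate sum by one, so k ∑ r = t - s > 0.
  have hkpos : 0 < k := by
    have h := congrArg (fun h : V → ℤ => ∑ v, h v) hk
    simp only [Pi.sub_apply, Pi.smul_apply, smul_eq_mul, Finset.sum_sub_distrib, hsum,
      ← Finset.mul_sum] at h
    have h0 : 0 ≤ ∑ v, G.rVec v := Finset.sum_nonneg fun v _ => (G.rVec_pos v).le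
    refine pos_of_mul_pos_left (b := ∑ v, G.rVec v) ?_ h0
    omega
  exact ⟨{
    N := t - s
    k := k
    f := fun i => f (s + i)
    u := fun i => φ (f (s + i))
    k_pos := hkpos
    f_succ := fun i _ => hf (s + i)
    f_last := by
      rw [← hk, show s + (t - s) = t by omega, add_zero, sub_sub_cancel]
    lt := fun i _ => hφ _ }⟩

/-! ### Degree bound, reflection and domination for Σ(Λ) -/

variable (G)

/-- The canonical divisor `δ_v - 2` of an arithmetical graph. -/
def canonicalDivisor (v : V) : ℤ := (G.δ v : ℤ) - 2

variable {G}

theorem deg_le_of_mem_sigmaRegion {g : ℤ} (hg : G.IsGZero g) {D : V → ℤ}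
    (hD : D ∈ sigmaRegion G.lattice) : deg G.r D ≤ g - 1 :=
  (nonempty_firingCycle hD).elim fun c => c.deg_le hg

theorem canonicalDivisor_sub_mem_sigmaRegion {g : ℤ} (hg : G.IsGZero g) {D : V → ℤ}
    (hD : D ∈ sigmaRegion G.lattice) (hdeg : deg G.r D = g - 1) :
    G.canonicalDivisor - D ∈ sigmaRegion G.lattice :=
  (nonempty_firingCycle hD).elim fun c => (c.reflect hg hdeg).mem_sigmaRegion

/-- An extreme divisor above D has degree at least g - 1 by minimality and at most g - 1 by the
potential bound. -/
theorem exists_ge_deg_eq {g : ℤ} (hg : G.IsGZero g) (hmin : IsGMin G.r G.lattice g) {D : V → ℤ}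
    (hD : D ∈ sigmaRegion G.lattice) :
    ∃ E ∈ sigmaRegion G.lattice, D ≤ E ∧ deg G.r E = g - 1 := by
  obtain ⟨E, hE, hDE⟩ := exists_extremeDivisors_ge (fun _ => deg_le_of_mem_sigmaRegion hg) hD
  exact ⟨E, hE.1, hDE, le_antisymm (deg_le_of_mem_sigmaRegion hg hE.1) (hmin.2 ⟨E, hE, rfl⟩)⟩

/-! ### Transfer to the directed graph by scaling -/

variable (G)

/-- Multiplication by the multiplicities, as a linear map. -/
def scale : (V → ℤ) →ₗ[ℤ] V → ℤ := LinearMap.mulLeft ℤ G.rVec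

theorem scale_apply (D : V → ℤ) (v : V) : G.scale D v = G.rVec v * D v := rfl

theorem scale_injective : Function.Injective G.scale := fun _ _ h => funext fun v =>
  mul_left_cancel₀ (G.rVec_pos v).ne' (congrFun h v)

theorem outDegree_toDirected (v : V) : (G.toDirected.outDegree v : ℤ) = G.rVec v * G.δ v := by
  have h := congrFun G.laplacian_mulVec_rVec v
  rw [laplacian_mulVec_apply, Pi.zero_apply, sub_eq_zero] at h
  rw [mul_comm, h, DirectedMultigraph.outDegree]
  push_cast [toDirected]
  rfl

theorem rowLattice_toDirected : G.toDirected.rowLattice = G.lattice.map G.scale := by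
  rw [lattice, Submodule.map_span, ← Set.range_comp, DirectedMultigraph.rowLattice]
  congr 2
  ext u v
  simp only [Function.comp_apply, scale_apply, row_apply, col_apply, laplacian,
    DirectedMultigraph.laplacian, Matrix.sub_apply, mul_sub, outDegree_toDirected]
  congr 1
  · rcases eq_or_ne u v with rfl | h
    · simp
    · simp [h, h.symm]
  · simp [DirectedMultigraph.adjMatrix, ConnectedMultigraph.adjMatrix, toDirected, rVec,
      G.symm u v, mul_comm]

theorem deg_one_scale (D : V → ℤ) : deg (fun _ => 1) (G.scale D) = deg G.r D := by
  simp [deg, scale_apply, rVec]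

theorem isFullRankSublattice_rowLattice :
    IsFullRankSublattice (fun _ => 1) G.toDirected.rowLattice := by
  rw [rowLattice_toDirected]
  refine ⟨?_, ?_⟩
  · rintro _ ⟨D, hD, rfl⟩
    rw [deg_one_scale]
    exact G.isFullRankSublattice_lattice.1 D hD
  · rw [← (Submodule.equivMapOfInjective G.scale G.scale_injective G.lattice).finrank_eq]
    exact G.isFullRankSublattice_lattice.2

theorem mem_sigmaRegion_rowLattice {D : V → ℤ} :
    D ∈ sigmaRegion G.toDirected.rowLattice ↔ D / G.rVec ∈ sigmaRegion G.lattice := by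
  rw [rowLattice_toDirected]
  have h : ∀ p : V → ℤ, G.scale p ≤ D ↔ p ≤ D / G.rVec := fun p =>
    forall_congr' fun v => by
      rw [scale_apply, Pi.div_apply, Int.le_ediv_iff_mul_le (G.rVec_pos v), mul_comm]
  constructor
  · exact fun hD p hp hpD => hD _ (Submodule.mem_map_of_mem hp) ((h p).2 hpD)
  · rintro hD _ ⟨p, hp, rfl⟩ hpD
    exact hD p hp ((h p).1 hpD)

/-- The largest divisor whose quotient by the multiplicities, rounded down, is `D`. -/
def inflate (D : V → ℤ) : V → ℤ := G.scale D + (G.rVec - 1)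

theorem inflate_div (D : V → ℤ) : G.inflate D / G.rVec = D := by
  ext v
  have h := G.rVec_pos v
  simp only [inflate, scale_apply, Pi.div_apply, Pi.add_apply, Pi.sub_apply, Pi.one_apply]
  rw [add_comm, Int.add_mul_ediv_left _ _ h.ne', Int.ediv_eq_zero_of_lt (by omega) (by omega),
    zero_add]

theorem le_inflate_div (D : V → ℤ) : D ≤ G.inflate (D / G.rVec) := by
  intro v
  have h1 := Int.emod_lt_of_pos (D v) (G.rVec_pos v)
  have h2 := Int.emod_add_mul_ediv (D v) (G.rVec v)
  simp only [inflate, scale_apply, Pi.div_apply, Pi.add_apply, Pi.sub_apply, Pi.one_apply]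
  linarith

theorem inflate_mono : Monotone G.inflate := fun _ _ h v =>
  add_le_add_left (mul_le_mul_of_nonneg_left (h v) (G.rVec_pos v).le) _

theorem deg_inflate (D : V → ℤ) :
    deg (fun _ => 1) (G.inflate D) = deg G.r D + deg (fun _ => 1) (G.rVec - 1) := by
  rw [inflate, deg_add, deg_one_scale]

/-- Consequently reflecting `inflate E` in the natural divisor gives `inflate (K - E)`, with K =
`canonicalDivisor`. -/
theorem naturalDivisor_toDirected :
    G.toDirected.naturalDivisor = G.inflate G.canonicalDivisor + (G.rVec - 1) := by
  ext v
  simp only [DirectedMultigraph.naturalDivisor, outDegree_toDirected, inflate, scale_apply,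
    canonicalDivisor, Pi.add_apply, Pi.sub_apply, Pi.one_apply]
  ring

/-! ### The two Riemann–Roch properties -/

variable {G}

theorem deg_canonicalDivisor {g : ℤ} (hg : G.IsGZero g) :
    deg G.r G.canonicalDivisor = 2 * g - 2 := hg.symm

theorem hasRiemannRochWith_canonicalDivisor {g : ℤ} (hg : G.IsGZero g)
    (hmin : IsGMin G.r G.lattice g) : HasRiemannRochWith G.r G.lattice G.canonicalDivisor := by
  obtain ⟨D, hD, -⟩ := hmin.1
  exact hasRiemannRochWith_of_reflection G.r_pos G.isFullRankSublattice_lattice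
    (deg_canonicalDivisor hg) ⟨D, hD.1⟩ (fun _ => deg_le_of_mem_sigmaRegion hg)
    (fun _ => exists_ge_deg_eq hg hmin) (fun _ => canonicalDivisor_sub_mem_sigmaRegion hg)

theorem hasNaturalRiemannRoch_toDirected {g : ℤ} (hg : G.IsGZero g)
    (hmin : IsGMin G.r G.lattice g) : G.toDirected.HasNaturalRiemannRoch := by
  have hle : ∀ D ∈ sigmaRegion G.toDirected.rowLattice,
      deg (fun _ => 1) D ≤ g + deg (fun _ => 1) (G.rVec - 1) - 1 := by
    intro D hD
    have h1 := deg_mono (fun _ => 1) (G.le_inflate_div D)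
    have h2 := deg_le_of_mem_sigmaRegion hg (G.mem_sigmaRegion_rowLattice.1 hD)
    rw [deg_inflate] at h1
    linarith
  have hinf : ∀ D ∈ sigmaRegion G.lattice,
      G.inflate D ∈ sigmaRegion G.toDirected.rowLattice := fun D hD => by
    rwa [mem_sigmaRegion_rowLattice, inflate_div]
  refine hasRiemannRochWith_of_reflection (g := g + deg (fun _ => 1) (G.rVec - 1))
    (fun _ => Nat.one_pos) G.isFullRankSublattice_rowLattice ?_ ?_ hle ?_ ?_
  · rw [naturalDivisor_toDirected, deg_add, deg_inflate, deg_canonicalDivisor hg]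
    ring
  · obtain ⟨D, hD, -⟩ := hmin.1
    exact ⟨_, hinf D hD.1⟩
  · intro D hD
    obtain ⟨E, hE, hDE, hdeg⟩ := exists_ge_deg_eq hg hmin (G.mem_sigmaRegion_rowLattice.1 hD)
    refine ⟨G.inflate E, hinf E hE, (G.le_inflate_div D).trans (G.inflate_mono hDE), ?_⟩
    rw [deg_inflate, hdeg]
    ring
  · intro D hD hdeg
    have hD' := G.mem_sigmaRegion_rowLattice.1 hD
    have hle' := deg_le_of_mem_sigmaRegion hg hD'
    -- D already has the largest degree possible on Σ, so rounding down and inflating cannot raise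
    -- it.
    have heq : D = G.inflate (D / G.rVec) := by
      refine eq_of_le_of_deg_le (fun _ => Nat.one_pos) (G.le_inflate_div D) ?_
      rw [hdeg, deg_inflate]
      linarith
    have hdeg' : deg G.r (D / G.rVec) = g - 1 := by
      have := deg_inflate G (D / G.rVec)
      rw [← heq] at this
      linarith
    convert hinf _ (canonicalDivisor_sub_mem_sigmaRegion hg hD' hdeg') using 1
    conv_lhs => rw [heq]
    rw [naturalDivisor_toDirected, inflate, inflate, inflate, map_sub]
    abel

end ArithmeticalGraph

end ChipFiring

theorem mainTheorem10 {V : Type*} [Fintype V] [DecidableEq V]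
    (G : ChipFiring.ArithmeticalGraph V) (g : ℤ) (hg₀ : G.IsGZero g)
    (hmin : ChipFiring.IsGMin G.r G.lattice g) (hmax : ChipFiring.IsGMax G.r G.lattice g) :
    ChipFiring.HasRiemannRoch G.r G.lattice ∧ G.toDirected.HasNaturalRiemannRoch := by
  exact ⟨⟨_, ChipFiring.ArithmeticalGraph.hasRiemannRochWith_canonicalDivisor hg₀ hmin⟩,
    ChipFiring.ArithmeticalGraph.hasNaturalRiemannRoch_toDirected hg₀ hmin⟩
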